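/- Let $K$ be a field, let $\mathscr X$ be a (small) partially ordered set, regarded as a category with a unique morphism $x\to y$ whenever $x\le y$, and let $\mathcal C:\mathscr X\to Coalg$ be a functor to the category of (coassociative, counital) $K$-coalgebras. For a $K$-coalgebra $C$ let $\mathbf M_{[C,-]}$ be the category of right $C$-contramodules: vector spaces $M$ with a linear contraction $\pi:Hom_K(C,M)\to M$ that is contraunital and contraassociative with respect to $Hom_K(C,Hom_K(C,M))\cong Hom_K(C\otimes C,M)$, $g\mapsto (c\otimes c'\mapsto g(c)(c'))$. In particular $C^*=Hom_K(C,K)$ is the free $C$-contramodule on $K$. For a morphism $\alpha:C\to D$ of coalgebras let $\alpha_\bullet:\mathbf M_{[C,-]}\to\mathbf M_{[D,-]}$ be contrarestriction of scalars (same vector space, contraction $f\mapsto \pi(f\circ\alpha)$), and let $\alpha^\bullet:\mathbf M_{[D,-]}\to\mathbf M_{[C,-]}$, $\alpha^\bullet M=Cohom_D(C,M)$, be its left adjoint, the contraextension of scalars; here $Cohom_D(C,M)$ is the coequalizer of the two maps $Hom_K(C\otimes D,M)\cong Hom_K(C,Hom_K(D,M))\rightrightarrows Hom_K(C,M)$ induced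 by the right $D$-coaction on $C$ and by the contraction of $M$. Let $Cont^{tr}\text{-}\mathcal C$ be the category of right trans-contramodules over $\mathcal C$: an object $\mathcal M$ consists of a $\mathcal C_x$-contramodule $\mathcal M_x$ for each $x\in\mathscr X$ and a morphism ${}_\alpha\mathcal M:\mathcal M_y\to\alpha_\bullet\mathcal M_x$ of $\mathcal C_y$-contramodules for each $\alpha:x\to y$, with ${}_{id}\mathcal M=id$ and ${}_{\beta\alpha}\mathcal M=\beta_\bullet({}_\alpha\mathcal M)\circ{}_\beta\mathcal M$; a morphism is a family of contramodule morphisms $\mathcal M_x\to\mathcal N_x$ compatible with these structure maps. For $x\in\mathscr X$ let $ex_x:\mathbf M_{[\mathcal C_x,-]}\to Cont^{tr}\text{-}\mathcal C$ be the functor with $ex_x(N)_y=\alpha^\bullet N$ if there is a morphism $\alpha:y\to x$ and $ex_x(N)_y=0$ otherwise, with the canonical structure maps. Then $Cont^{tr}\text{-}\mathcal C$ is a locally presentable abelian category, and $\{ex_x(\mathcal C_x^*)\}_{x\in\mathscr X}$ is a set of projective generators of it (both in the sense that these objects jointly detect equality of parallel morphisms, and in the sense that for every non-invertible monomorphism $\mathcal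 N\to\mathcal M$ some morphism $ex_x(\mathcal C_x^*)\to\mathcal M$ does not factor through it). Moreover, there is a regular cardinal $\lambda_0$ such that $\mathcal C_x^*$ is $\lambda_0$-presentable in $\mathbf M_{[\mathcal C_x,-]}$ for every $x\in\mathscr X$; and for every such $\lambda_0$, each $ex_x(\mathcal C_x^*)$ is $\lambda_0$-presentable in $Cont^{tr}\text{-}\mathcal C$ and the category $Cont^{tr}\text{-}\mathcal C$ is locally $\lambda_0$-presentable. -/

import Mathlib

open CategoryTheory
open scoped TensorProduct

universe u

/-- A right contramodule over the `K`-coalgebra `C`: a `K`-vector space `M` with a linear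
contraction `π : Hom_K(C, M) → M` which is contraunital and contraassociative. In `contra_assoc`,
the identification `Hom_K(C, Hom_K(C, M)) ≅ Hom_K(C ⊗ C, M)` is `g ↦ (c ⊗ c' ↦ g c c')`, that is,
the adjunction between `- ⊗ C` and `Hom_K(C, -)`. -/
structure Contramodule (K : Type u) [Field K] (C : Type u) [AddCommGroup C] [Module K C]
    [Coalgebra K C] : Type (u + 1) where
  carrier : Type u
  [instAddCommGroup : AddCommGroup carrier]
  [instModule : Module K carrier]
  π : (C →ₗ[K] carrier) →ₗ[K] carrier
  contra_counit : ∀ m : carrier,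
    π (LinearMap.toSpanSingleton K carrier m ∘ₗ Coalgebra.counit) = m
  contra_assoc : ∀ g : C →ₗ[K] C →ₗ[K] carrier,
    π (π ∘ₗ g) = π (TensorProduct.lift g ∘ₗ Coalgebra.comul)

attribute [instance] Contramodule.instAddCommGroup Contramodule.instModule

namespace Contramodule

section Basic

variable {K : Type u} [Field K] {C : Type u} [AddCommGroup C] [Module K C] [Coalgebra K C]

/-- Morphisms of contramodules: linear maps commuting with the contractions. -/
@[ext]
structure Hom (M N : Contramodule K C) : Type u where
  lin : M.carrier →ₗ[K] N.carrier
  comm : ∀ f : C →ₗ[K] M.carrier, lin (M.π f) = N.π (lin ∘ₗ f)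

/-- The category of right `C`-contramodules. -/
instance : Category.{u} (Contramodule K C) where
  Hom M N := Hom M N
  id M := { lin := LinearMap.id, comm := fun f => by simp }
  comp {M N P} f g :=
    { lin := g.lin ∘ₗ f.lin
      comm := fun h => by
        rw [LinearMap.comp_apply, f.comm, g.comm, LinearMap.comp_assoc] }

@[ext]
theorem hom_ext {M N : Contramodule K C} {f g : M ⟶ N} (h : f.lin = g.lin) : f = g :=
  Hom.ext h

@[simp] theorem id_lin (M : Contramodule K C) : Hom.lin (𝟙 M) = LinearMap.id := rfl

@[simp] theorem comp_lin {M N P : Contramodule K C} (f : M ⟶ N) (g : N ⟶ P) :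
    (f ≫ g).lin = g.lin ∘ₗ f.lin := rfl

end Basic

section Free

variable {K : Type u} [Field K] {C : Type u} [AddCommGroup C] [Module K C] [Coalgebra K C]
variable {V : Type u} [AddCommGroup V] [Module K V]

variable (C V) in
/-- The linear map `Hom_K(C, Hom_K(C, V)) ≅ Hom_K(C ⊗ C, V) → Hom_K(C, V)`, where the last map is
composition with the comultiplication. -/
noncomputable def freeπ : (C →ₗ[K] C →ₗ[K] V) →ₗ[K] (C →ₗ[K] V) :=
  LinearMap.lcomp K V Coalgebra.comul ∘ₗ TensorProduct.uncurry (.id K) C C V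

theorem freeπ_eq (g : C →ₗ[K] C →ₗ[K] V) :
    freeπ C V g = TensorProduct.lift g ∘ₗ Coalgebra.comul := rfl

theorem freeπ_assoc (h : C →ₗ[K] C →ₗ[K] C →ₗ[K] V) :
    freeπ C V (freeπ C V ∘ₗ h) = freeπ C V (freeπ C (C →ₗ[K] V) h) := by
  have key : TensorProduct.lift (freeπ C V ∘ₗ h) =
      TensorProduct.lift (TensorProduct.uncurry (.id K) C C V ∘ₗ h) ∘ₗ
        LinearMap.lTensor C Coalgebra.comul := by
    ext a b
    simp only [TensorProduct.AlgebraTensorModule.curry_apply, LinearMap.restrictScalars_self,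
      TensorProduct.curry_apply, TensorProduct.lift.tmul, LinearMap.comp_apply, freeπ_eq,
      LinearMap.lTensor_tmul]
    rfl
  have key2 : TensorProduct.lift (freeπ C (C →ₗ[K] V) h) =
      TensorProduct.lift (TensorProduct.lift h) ∘ₗ LinearMap.rTensor C Coalgebra.comul := by
    ext a b
    simp [freeπ_eq]
  have key3 : TensorProduct.lift (TensorProduct.lift h) =
      TensorProduct.lift (TensorProduct.uncurry (.id K) C C V ∘ₗ h) ∘ₗ
        (TensorProduct.assoc K C C C).toLinearMap := by
    ext a b c
    simp
  ext c
  rw [freeπ_eq, freeπ_eq, key, key2, key3]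
  simp only [LinearMap.comp_apply, LinearEquiv.coe_coe, Coalgebra.coassoc_apply]

variable (K C V) in
/-- The free contramodule `T_C(V) = Hom_K(C, V)`. -/
noncomputable def free : Contramodule K C where
  carrier := C →ₗ[K] V
  π := freeπ C V
  contra_counit m := by
    ext c
    have key : TensorProduct.lift
        (LinearMap.toSpanSingleton K (C →ₗ[K] V) m ∘ₗ
          (Coalgebra.counit (R := K) (A := C))) =
        TensorProduct.lift ((LinearMap.lsmul K V).compl₂ m) ∘ₗ
          LinearMap.rTensor C Coalgebra.counit := by
      ext a b
      simp
    rw [freeπ_eq, key]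
    simp
  contra_assoc h := freeπ_assoc h

variable (K C) in
/-- The contramodule `C^* = Hom_K(C, K) = T_C(K)`. -/
noncomputable def dual : Contramodule K C := free K C K

end Free

section Quotient

variable {K : Type u} [Field K] {C : Type u} [AddCommGroup C] [Module K C] [Coalgebra K C]

theorem exists_section {V : Type u} [AddCommGroup V] [Module K V] (R : Submodule K V) :
    ∃ s : (V ⧸ R) →ₗ[K] V, R.mkQ ∘ₗ s = LinearMap.id :=
  R.mkQ.exists_rightInverse_of_surjective R.range_mkQ

/-- The contraction on the quotient of `P` by a subcontramodule `R`: lift `C → P / R` to a map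
`C → P`, contract, and project. The result does not depend on the lift
(see `quotientπ_mkQ_comp`). -/
noncomputable def quotientπ (P : Contramodule K C) (R : Submodule K P.carrier) :
    (C →ₗ[K] (P.carrier ⧸ R)) →ₗ[K] (P.carrier ⧸ R) :=
  R.mkQ ∘ₗ P.π ∘ₗ LinearMap.compRight K (exists_section R).choose

theorem quotientπ_mkQ_comp (P : Contramodule K C) (R : Submodule K P.carrier)
    (hR : ∀ f : C →ₗ[K] P.carrier, (∀ c, f c ∈ R) → P.π f ∈ R) (f : C →ₗ[K] P.carrier) :
    quotientπ P R (R.mkQ ∘ₗ f) = R.mkQ (P.π f) := by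
  have hs := (exists_section R).choose_spec
  set s := (exists_section R).choose with hsdef
  change R.mkQ (P.π (s ∘ₗ R.mkQ ∘ₗ f)) = R.mkQ (P.π f)
  rw [← sub_eq_zero, ← map_sub, ← map_sub, Submodule.mkQ_apply, Submodule.Quotient.mk_eq_zero]
  apply hR
  intro c
  rw [← Submodule.Quotient.mk_eq_zero, ← Submodule.mkQ_apply, LinearMap.sub_apply, map_sub,
    sub_eq_zero]
  exact LinearMap.congr_fun hs (R.mkQ (f c))

theorem exists_lift {V : Type u} [AddCommGroup V] [Module K V] (R : Submodule K V)
    {W : Type u} [AddCommGroup W] [Module K W] (f : W →ₗ[K] (V ⧸ R)) :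
    ∃ g : W →ₗ[K] V, R.mkQ ∘ₗ g = f := by
  obtain ⟨s, hs⟩ := exists_section R
  exact ⟨s ∘ₗ f, by rw [← LinearMap.comp_assoc, hs, LinearMap.id_comp]⟩

/-- The quotient of the contramodule `P` by a subcontramodule `R`. -/
noncomputable def quotient (P : Contramodule K C) (R : Submodule K P.carrier)
    (hR : ∀ f : C →ₗ[K] P.carrier, (∀ c, f c ∈ R) → P.π f ∈ R) : Contramodule K C where
  carrier := P.carrier ⧸ R
  π := quotientπ P R
  contra_counit m := by
    obtain ⟨p, rfl⟩ := R.mkQ_surjective m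
    have : LinearMap.toSpanSingleton K (P.carrier ⧸ R) (R.mkQ p) ∘ₗ Coalgebra.counit =
        R.mkQ ∘ₗ LinearMap.toSpanSingleton K P.carrier p ∘ₗ
          (Coalgebra.counit (R := K) (A := C)) := by
      ext c
      simp
    rw [this, quotientπ_mkQ_comp P R hR, P.contra_counit]
  contra_assoc g := by
    have hs := (exists_section R).choose_spec
    set s := (exists_section R).choose with hsdef
    have hg : g = LinearMap.compRight K R.mkQ ∘ₗ (LinearMap.compRight K s ∘ₗ g) := by
      ext c c'
      exact (LinearMap.congr_fun hs (g c c')).symm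
    set g' : C →ₗ[K] C →ₗ[K] P.carrier := LinearMap.compRight K s ∘ₗ g with hg'
    have h1 : quotientπ P R ∘ₗ g = R.mkQ ∘ₗ P.π ∘ₗ g' := rfl
    have h2 : TensorProduct.lift g = R.mkQ ∘ₗ TensorProduct.lift g' := by
      rw [hg]
      ext a b
      simp
    rw [h1, h2, LinearMap.comp_assoc, quotientπ_mkQ_comp P R hR, quotientπ_mkQ_comp P R hR,
      P.contra_assoc]

end Quotient

section Scalars

variable {K : Type u} [Field K]
variable {C : Type u} [AddCommGroup C] [Module K C] [Coalgebra K C]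
variable {D : Type u} [AddCommGroup D] [Module K D] [Coalgebra K D]

/-- The contrarestriction of scalars `α_•` along a morphism of coalgebras `α : C → D`. -/
def contrarestriction (α : C →ₗc[K] D) : Contramodule K C ⥤ Contramodule K D where
  obj M :=
    { carrier := M.carrier
      π := M.π ∘ₗ LinearMap.lcomp K M.carrier α.toLinearMap
      contra_counit := fun m => by
        have : (LinearMap.toSpanSingleton K M.carrier m ∘ₗ
            (Coalgebra.counit (R := K) (A := D))) ∘ₗ α.toLinearMap =
            LinearMap.toSpanSingleton K M.carrier m ∘ₗ Coalgebra.counit := by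
          rw [LinearMap.comp_assoc, α.counit_comp]
        exact (congrArg M.π this).trans (M.contra_counit m)
      contra_assoc := fun g => by
        have h := M.contra_assoc (LinearMap.lcomp K M.carrier α.toLinearMap ∘ₗ g ∘ₗ α.toLinearMap)
        have h2 : TensorProduct.lift
              (LinearMap.lcomp K M.carrier α.toLinearMap ∘ₗ g ∘ₗ α.toLinearMap) ∘ₗ
              Coalgebra.comul =
            (TensorProduct.lift g ∘ₗ Coalgebra.comul) ∘ₗ α.toLinearMap := by
          rw [LinearMap.comp_assoc, ← α.map_comp_comul, ← LinearMap.comp_assoc (Coalgebra.comul (R := K) (A := C))]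
          refine congrArg (fun t : C ⊗[K] C →ₗ[K] M.carrier => t ∘ₗ Coalgebra.comul) ?_
          ext a b
          simp
        rw [h2] at h
        exact h }
  map f :=
    { lin := f.lin
      comm := fun h => f.comm (h ∘ₗ α.toLinearMap) }

/-- The right `D`-coaction `C → C ⊗ D` on `C` induced by a morphism of coalgebras `α : C → D`. -/
noncomputable def rightCoaction (α : C →ₗc[K] D) : C →ₗ[K] C ⊗[K] D :=
  LinearMap.lTensor C α.toLinearMap ∘ₗ Coalgebra.comul

/-- The difference of the two maps `Hom_K(C ⊗ D, M) ≅ Hom_K(C, Hom_K(D, M)) ⇉ Hom_K(C, M)`, one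
induced by the contraction of `M` and the other by the right `D`-coaction on `C`. -/
noncomputable def cohomRel (α : C →ₗc[K] D) (M : Contramodule K D) :
    (C →ₗ[K] D →ₗ[K] M.carrier) →ₗ[K] (C →ₗ[K] M.carrier) :=
  LinearMap.compRight K M.π -
    LinearMap.lcomp K M.carrier (rightCoaction α) ∘ₗ
      TensorProduct.uncurry (.id K) C D M.carrier

theorem cohomRel_apply (α : C →ₗc[K] D) (M : Contramodule K D)
    (g : C →ₗ[K] D →ₗ[K] M.carrier) :
    cohomRel α M g = M.π ∘ₗ g - TensorProduct.lift g ∘ₗ rightCoaction α := rfl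

theorem lift_comp_rightCoaction (α : C →ₗc[K] D) {V : Type u} [AddCommGroup V] [Module K V]
    (g : C →ₗ[K] D →ₗ[K] V) :
    TensorProduct.lift g ∘ₗ rightCoaction α =
      freeπ C V (LinearMap.lcomp K V α.toLinearMap ∘ₗ g) := by
  rw [freeπ_eq, rightCoaction, ← LinearMap.comp_assoc]
  congr 1
  ext a b
  simp

theorem freeπ_cohomRel_comp (α : C →ₗc[K] D) (M : Contramodule K D)
    (h : C →ₗ[K] C →ₗ[K] D →ₗ[K] M.carrier) :
    freeπ C M.carrier (cohomRel α M ∘ₗ h) =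
      cohomRel α M (freeπ C (D →ₗ[K] M.carrier) h) := by
  have h1 : cohomRel α M ∘ₗ h = LinearMap.compRight K M.π ∘ₗ h -
      freeπ C M.carrier ∘ₗ
        (LinearMap.compRight K (LinearMap.lcomp K M.carrier α.toLinearMap) ∘ₗ h) := by
    refine LinearMap.ext fun c => ?_
    change cohomRel α M (h c) = _
    rw [cohomRel_apply, lift_comp_rightCoaction]
    rfl
  have h2 : freeπ C M.carrier (LinearMap.compRight K M.π ∘ₗ h) =
      M.π ∘ₗ freeπ C (D →ₗ[K] M.carrier) h := by
    rw [freeπ_eq, freeπ_eq, ← LinearMap.comp_assoc]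
    congr 1
    ext a b
    simp
  have h3 : freeπ C (C →ₗ[K] M.carrier)
        (LinearMap.compRight K (LinearMap.lcomp K M.carrier α.toLinearMap) ∘ₗ h) =
      LinearMap.lcomp K M.carrier α.toLinearMap ∘ₗ freeπ C (D →ₗ[K] M.carrier) h := by
    rw [freeπ_eq, freeπ_eq, ← LinearMap.comp_assoc]
    congr 1
    ext a b
    simp
  rw [h1, map_sub, freeπ_assoc, h2, h3, cohomRel_apply, lift_comp_rightCoaction]

theorem range_cohomRel_closed (α : C →ₗc[K] D) (M : Contramodule K D)
    (f : C →ₗ[K] (free K C M.carrier).carrier)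
    (hf : ∀ c, f c ∈ LinearMap.range (cohomRel α M)) :
    (free K C M.carrier).π f ∈ LinearMap.range (cohomRel α M) := by
  obtain ⟨t, ht⟩ := (cohomRel α M).rangeRestrict.exists_rightInverse_of_surjective
    (LinearMap.range_rangeRestrict _)
  let f' : C →ₗ[K] LinearMap.range (cohomRel α M) := LinearMap.codRestrict _ f hf
  have h : f = cohomRel α M ∘ₗ (t ∘ₗ f') := by
    ext1 c
    have := congrArg Subtype.val (LinearMap.congr_fun ht (f' c))
    exact this.symm
  rw [h]
  exact ⟨_, (freeπ_cohomRel_comp α M (t ∘ₗ f')).symm⟩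

/-- The contraextension of scalars `α^• M = Cohom_D(C, M)` along `α : C → D`, on objects: the
coequalizer of `Hom_K(C ⊗ D, M) ⇉ Hom_K(C, M)`, with the `C`-contramodule structure induced by the
left `C`-comodule structure of `C`, i.e. as a quotient of the free contramodule
`T_C(M) = Hom_K(C, M)`. -/
noncomputable def contraextensionObj (α : C →ₗc[K] D) (M : Contramodule K D) :
    Contramodule K C :=
  (free K C M.carrier).quotient (LinearMap.range (cohomRel α M)) (range_cohomRel_closed α M)

theorem contraextensionObj_π_mkQ (α : C →ₗc[K] D) (M : Contramodule K D)
    (f : C →ₗ[K] C →ₗ[K] M.carrier) :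
    (contraextensionObj α M).π ((LinearMap.range (cohomRel α M)).mkQ ∘ₗ f) =
      (LinearMap.range (cohomRel α M)).mkQ (freeπ C M.carrier f) :=
  quotientπ_mkQ_comp (free K C M.carrier) _ (range_cohomRel_closed α M) f

theorem cohomRel_le_comap_compRight (α : C →ₗc[K] D) {M N : Contramodule K D} (u : M ⟶ N) :
    LinearMap.range (cohomRel α M) ≤
      (LinearMap.range (cohomRel α N)).comap (LinearMap.compRight K u.lin) := by
  rintro _ ⟨g, rfl⟩
  refine ⟨LinearMap.compRight K u.lin ∘ₗ g, ?_⟩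
  rw [cohomRel_apply, cohomRel_apply, map_sub]
  congr 1
  · refine LinearMap.ext fun c => ?_
    exact (u.comm (g c)).symm
  · change _ = u.lin ∘ₗ TensorProduct.lift g ∘ₗ rightCoaction α
    rw [← LinearMap.comp_assoc]
    congr 1
    ext a b
    simp

/-- The contraextension of scalars `α^•` on morphisms, induced by composition with `u`. -/
noncomputable def contraextensionMap (α : C →ₗc[K] D) {M N : Contramodule K D} (u : M ⟶ N) :
    contraextensionObj α M ⟶ contraextensionObj α N where
  lin := Submodule.mapQ (LinearMap.range (cohomRel α M)) (LinearMap.range (cohomRel α N))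
    (LinearMap.compRight K u.lin) (cohomRel_le_comap_compRight α u)
  comm f := by
    obtain ⟨f, rfl⟩ := exists_lift (V := C →ₗ[K] M.carrier) _ f
    refine (congrArg _ (contraextensionObj_π_mkQ α M f)).trans ?_
    refine Eq.trans ?_ (contraextensionObj_π_mkQ α N (LinearMap.compRight K u.lin ∘ₗ f)).symm
    refine congrArg (LinearMap.range (cohomRel α N)).mkQ ?_
    change u.lin ∘ₗ TensorProduct.lift f ∘ₗ Coalgebra.comul = _
    rw [freeπ_eq, ← LinearMap.comp_assoc]
    refine congrArg (fun t : C ⊗[K] C →ₗ[K] N.carrier => t ∘ₗ Coalgebra.comul) ?_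
    ext a b
    rfl

/-- The contraextension of scalars `α^•` along a morphism of coalgebras `α : C → D`. -/
noncomputable def contraextension (α : C →ₗc[K] D) : Contramodule K D ⥤ Contramodule K C where
  obj M := contraextensionObj α M
  map u := contraextensionMap α u
  map_id M := by
    apply hom_ext
    apply Submodule.linearMap_qext
    ext
    rfl
  map_comp u v := by
    apply hom_ext
    apply Submodule.linearMap_qext
    ext
    rfl

variable {B : Type u} [AddCommGroup B] [Module K B] [Coalgebra K B]

theorem cohomRel_le_comap_lcomp (α : C →ₗc[K] D) (β : B →ₗc[K] C) (α' : B →ₗc[K] D)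
    (h : α.comp β = α') (N : Contramodule K D) :
    LinearMap.range (cohomRel α N) ≤
      (LinearMap.range (cohomRel α' N)).comap (LinearMap.lcomp K N.carrier β.toLinearMap) := by
  subst h
  rintro _ ⟨g, rfl⟩
  refine ⟨g ∘ₗ β.toLinearMap, ?_⟩
  rw [cohomRel_apply, cohomRel_apply, map_sub]
  congr 1
  change _ = (TensorProduct.lift g ∘ₗ LinearMap.lTensor C α.toLinearMap ∘ₗ
    Coalgebra.comul) ∘ₗ β.toLinearMap
  rw [LinearMap.comp_assoc, LinearMap.comp_assoc, ← β.map_comp_comul, rightCoaction,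
    ← LinearMap.comp_assoc, ← LinearMap.comp_assoc, ← LinearMap.comp_assoc]
  congr 1
  ext a b
  simp

/-- For morphisms of coalgebras `β : B → C`, `α : C → D` with composite `α'`, the canonical morphism
`α^• N → β_• (α'^• N)` of `C`-contramodules, induced by
`- ∘ β : Hom_K(C, N) → Hom_K(B, N)`. It corresponds by adjunction to the canonical isomorphism
`β^• α^• N ≅ α'^• N`. -/
noncomputable def contraextensionTransition (α : C →ₗc[K] D) (β : B →ₗc[K] C) (α' : B →ₗc[K] D)
    (h : α.comp β = α') (N : Contramodule K D) :
    (contraextension α).obj N ⟶ (contrarestriction β).obj ((contraextension α').obj N) where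
  lin := Submodule.mapQ (LinearMap.range (cohomRel α N)) (LinearMap.range (cohomRel α' N))
    (LinearMap.lcomp K N.carrier β.toLinearMap) (cohomRel_le_comap_lcomp α β α' h N)
  comm f := by
    obtain ⟨f, rfl⟩ := exists_lift (V := C →ₗ[K] N.carrier) _ f
    refine (congrArg _ (contraextensionObj_π_mkQ α N f)).trans ?_
    refine Eq.trans ?_ (contraextensionObj_π_mkQ α' N
      (LinearMap.lcomp K N.carrier β.toLinearMap ∘ₗ f ∘ₗ β.toLinearMap)).symm
    refine congrArg (LinearMap.range (cohomRel α' N)).mkQ ?_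
    change (TensorProduct.lift f ∘ₗ Coalgebra.comul) ∘ₗ β.toLinearMap = _
    rw [freeπ_eq, LinearMap.comp_assoc, ← β.map_comp_comul, ← LinearMap.comp_assoc]
    refine congrArg (fun t : B ⊗[K] B →ₗ[K] N.carrier => t ∘ₗ Coalgebra.comul) ?_
    ext a b
    rfl

theorem contraextensionTransition_id (α : C →ₗc[K] D) (β : C →ₗc[K] C) (h : α.comp β = α)
    (hβ : β.toLinearMap = LinearMap.id) (N : Contramodule K D) (m : (contraextensionObj α N).carrier) :
    (contraextensionTransition α β α h N).lin m = m := by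
  obtain ⟨f, rfl⟩ := Submodule.mkQ_surjective _ m
  refine congrArg (Submodule.mkQ _) ?_
  change f ∘ₗ β.toLinearMap = f
  rw [hβ]
  rfl

theorem contraextensionTransition_comp {A : Type u} [AddCommGroup A] [Module K A] [Coalgebra K A]
    (α : C →ₗc[K] D) (β : B →ₗc[K] C) (α' : B →ₗc[K] D) (h : α.comp β = α')
    (γ : A →ₗc[K] B) (α'' : A →ₗc[K] D) (h' : α'.comp γ = α'')
    (δ : A →ₗc[K] C) (h'' : α.comp δ = α'') (hδ : δ.toLinearMap = β.toLinearMap ∘ₗ γ.toLinearMap)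
    (N : Contramodule K D) (m : (contraextensionObj α N).carrier) :
    (contraextensionTransition α δ α'' h'' N).lin m =
      (contraextensionTransition α' γ α'' h' N).lin
        ((contraextensionTransition α β α' h N).lin m) := by
  obtain ⟨f, rfl⟩ := Submodule.mkQ_surjective _ m
  refine congrArg (Submodule.mkQ _) ?_
  change f ∘ₗ δ.toLinearMap = (f ∘ₗ β.toLinearMap) ∘ₗ γ.toLinearMap
  rw [hδ]
  rfl

theorem contraextensionTransition_naturality (α : C →ₗc[K] D) (β : B →ₗc[K] C)
    (α' : B →ₗc[K] D) (h : α.comp β = α') {N N' : Contramodule K D} (u : N ⟶ N')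
    (m : (contraextensionObj α N).carrier) :
    ((contraextension α').map u).lin ((contraextensionTransition α β α' h N).lin m) =
      (contraextensionTransition α β α' h N').lin (((contraextension α).map u).lin m) := by
  obtain ⟨f, rfl⟩ := Submodule.mkQ_surjective _ m
  rfl

end Scalars

section Pi

variable {K : Type u} [Field K] {C : Type u} [AddCommGroup C] [Module K C] [Coalgebra K C]

/-- The product of a family of contramodules. -/
def pi {ι : Type u} (M : ι → Contramodule K C) : Contramodule K C where
  carrier := ∀ i, (M i).carrier
  π := LinearMap.pi fun i => (M i).π ∘ₗ LinearMap.compRight K (LinearMap.proj i)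
  contra_counit m := by
    funext i
    refine Eq.trans ?_ ((M i).contra_counit (m i))
    exact congrArg (M i).π (LinearMap.ext fun c => rfl)
  contra_assoc g := by
    funext i
    let p : (∀ i, (M i).carrier) →ₗ[K] (M i).carrier := LinearMap.proj i
    have key : TensorProduct.lift (LinearMap.compRight K p ∘ₗ g) = p ∘ₗ TensorProduct.lift g := by
      ext a b
      simp
    have h := (M i).contra_assoc (LinearMap.compRight K p ∘ₗ g)
    rw [key] at h
    exact h

/-- The projections from a product of contramodules. -/
def proj {ι : Type u} (M : ι → Contramodule K C) (i : ι) : pi M ⟶ M i where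
  lin := LinearMap.proj i
  comm _ := rfl

/-- The zero morphism. -/
def zeroHom (M N : Contramodule K C) : M ⟶ N where
  lin := 0
  comm f := by simp

end Pi

end Contramodule

/-- A right trans-contramodule over a coalgebra representation `𝒞 : X ⥤ Coalg`. -/
structure TransContramodule {K : Type u} [Field K] {X : Type u} [SmallCategory X]
    (𝒞 : X ⥤ CoalgCat.{u} K) : Type (u + 1) where
  obj (x : X) : Contramodule K (𝒞.obj x)
  map {x y : X} (α : x ⟶ y) :
    obj y ⟶ (Contramodule.contrarestriction (𝒞.map α).toCoalgHom).obj (obj x)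
  map_id (x : X) (m : (obj x).carrier) : (map (𝟙 x)).lin m = m
  map_comp {x y z : X} (α : x ⟶ y) (β : y ⟶ z) (m : (obj z).carrier) :
    (map (α ≫ β)).lin m = (map α).lin ((map β).lin m)

namespace TransContramodule

section

variable {K : Type u} [Field K] {X : Type u} [SmallCategory X] {𝒞 : X ⥤ CoalgCat.{u} K}

/-- Morphisms of trans-contramodules. -/
@[ext]
structure Hom (M N : TransContramodule 𝒞) : Type u where
  app (x : X) : M.obj x ⟶ N.obj x
  naturality {x y : X} (α : x ⟶ y) :
    M.map α ≫ (Contramodule.contrarestriction (𝒞.map α).toCoalgHom).map (app x) =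
      app y ≫ N.map α

/-- The category of right trans-contramodules over `𝒞`. -/
instance : Category.{u} (TransContramodule 𝒞) where
  Hom M N := Hom M N
  id M := { app := fun x => 𝟙 (M.obj x), naturality := fun α => by simp }
  comp f g :=
    { app := fun x => f.app x ≫ g.app x
      naturality := fun α => by
        rw [Functor.map_comp, ← Category.assoc, f.naturality, Category.assoc, g.naturality,
          Category.assoc] }

end

section Extension

variable {K : Type u} [Field K] {X : Type u} [PartialOrder X] (𝒞 : X ⥤ CoalgCat.{u} K) (x : X)
  (N : Contramodule K (𝒞.obj x))

/-- The value at `y` of `ex_x(N)`, for a representation of a poset `X`: the product of the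
contramodules `α^• N` over `α ∈ X(y, x)`. Since `X` is a poset, this is `α^• N` if `y ≤ x`, with
`α : y → x` the unique morphism (see `proj_bijective`), and `0` otherwise
(see `exValue_subsingleton`). -/
noncomputable def exValue (y : X) : Contramodule K (𝒞.obj y) :=
  Contramodule.pi fun α : y ⟶ x => (Contramodule.contraextension (𝒞.map α).toCoalgHom).obj N

theorem proj_bijective {y : X} (α : y ⟶ x) :
    Function.Bijective (Contramodule.proj (fun α : y ⟶ x =>
      (Contramodule.contraextension (𝒞.map α).toCoalgHom).obj N) α).lin := by
  constructor
  · intro m n h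
    funext β
    obtain rfl : β = α := Subsingleton.elim _ _
    exact h
  · intro n
    refine ⟨fun β => (Subsingleton.elim α β) ▸ n, rfl⟩

theorem exValue_subsingleton {y : X} (h : ¬ y ≤ x) : Subsingleton (exValue 𝒞 x N y).carrier :=
  ⟨fun _ _ => funext fun α => absurd (leOfHom α) h⟩

theorem exComponent_comp_eq {z y : X} (β : z ⟶ y) (γ : z ⟶ x) (α : y ⟶ x) :
    (𝒞.map α).toCoalgHom.comp (𝒞.map β).toCoalgHom = (𝒞.map γ).toCoalgHom := by
  rw [← CoalgCat.toCoalgHom_comp, ← Functor.map_comp]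
  congr 1

open Classical in
/-- The components of the structure morphisms of `ex_x(N)`: for `β : z → y` and `γ : z → x`, the
canonical map `α^• N → β_• (γ^• N)` if there is `α : y → x` (so that `γ = αβ`), and `0`
otherwise. -/
noncomputable def exComponent {z y : X} (β : z ⟶ y) (γ : z ⟶ x) :
    exValue 𝒞 x N y ⟶ (Contramodule.contrarestriction (𝒞.map β).toCoalgHom).obj
      ((Contramodule.contraextension (𝒞.map γ).toCoalgHom).obj N) :=
  if h : y ≤ x then
    Contramodule.proj _ (homOfLE h) ≫
      Contramodule.contraextensionTransition (𝒞.map (homOfLE h)).toCoalgHom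
        (𝒞.map β).toCoalgHom (𝒞.map γ).toCoalgHom
        (exComponent_comp_eq 𝒞 x β γ (homOfLE h)) N
  else Contramodule.zeroHom _ _

theorem exComponent_lin {z y : X} (β : z ⟶ y) (γ : z ⟶ x) (α : y ⟶ x)
    (m : (exValue 𝒞 x N y).carrier) :
    (exComponent 𝒞 x N β γ).lin m =
      (Contramodule.contraextensionTransition (𝒞.map α).toCoalgHom (𝒞.map β).toCoalgHom
        (𝒞.map γ).toCoalgHom (exComponent_comp_eq 𝒞 x β γ α) N).lin (m α) := by
  have h : y ≤ x := leOfHom α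
  obtain rfl : homOfLE h = α := Subsingleton.elim _ _
  have e : exComponent 𝒞 x N β γ = _ := dif_pos h
  rw [e]
  rfl

/-- The functor `ex_x` on objects, for a representation of a poset `X`. -/
noncomputable def exObj : TransContramodule 𝒞 where
  obj y := exValue 𝒞 x N y
  map {z y} β :=
    { lin := LinearMap.pi fun γ : z ⟶ x => (exComponent 𝒞 x N β γ).lin
      comm := fun f => funext fun γ => (exComponent 𝒞 x N β γ).comm f }
  map_id y m := by
    funext γ
    refine (exComponent_lin 𝒞 x N (𝟙 y) γ γ m).trans ?_
    refine Contramodule.contraextensionTransition_id _ _ _ ?_ N (m γ)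
    rw [CategoryTheory.Functor.map_id]
    rfl
  map_comp {w z y} β γ m := by
    funext δ
    change (exComponent 𝒞 x N (β ≫ γ) δ).lin m = (exComponent 𝒞 x N β δ).lin
      (fun ε => (exComponent 𝒞 x N γ ε).lin m)
    by_cases h : y ≤ x
    · refine (exComponent_lin 𝒞 x N (β ≫ γ) δ (homOfLE h) m).trans (Eq.trans ?_
        (exComponent_lin 𝒞 x N β δ (γ ≫ homOfLE h)
          (fun ε => (exComponent 𝒞 x N γ ε).lin m)).symm)
      refine Eq.trans ?_ (congrArg _
        (exComponent_lin 𝒞 x N γ (γ ≫ homOfLE h) (homOfLE h) m).symm)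
      refine Contramodule.contraextensionTransition_comp _ _ _ _ _ _ _ _ _ ?_ N _
      rw [CategoryTheory.Functor.map_comp]
      rfl
    · have h0 : m = 0 := @Subsingleton.elim _ (exValue_subsingleton 𝒞 x N h) _ _
      subst h0
      have h1 : (fun ε : z ⟶ x => (exComponent 𝒞 x N γ ε).lin (0 : (exValue 𝒞 x N y).carrier)) =
          (0 : (exValue 𝒞 x N z).carrier) := funext fun ε => map_zero _
      refine (map_zero _).trans ?_
      exact ((congrArg (exComponent 𝒞 x N β δ).lin h1).trans (map_zero _)).symm

/-- The functor `ex_x` on morphisms. -/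
noncomputable def exMap {N N' : Contramodule K (𝒞.obj x)} (u : N ⟶ N') :
    exObj 𝒞 x N ⟶ exObj 𝒞 x N' where
  app y :=
    { lin := LinearMap.pi fun α : y ⟶ x =>
        (Contramodule.proj _ α ≫
          (Contramodule.contraextension (𝒞.map α).toCoalgHom).map u).lin
      comm := fun f => funext fun α => (Contramodule.proj _ α ≫
        (Contramodule.contraextension (𝒞.map α).toCoalgHom).map u).comm f }
  naturality {z y} β := by
    apply Contramodule.hom_ext
    refine LinearMap.ext fun m => funext fun γ => ?_
    change ((Contramodule.contraextension (𝒞.map γ).toCoalgHom).map u).lin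
      ((exComponent 𝒞 x N β γ).lin m) = (exComponent 𝒞 x N' β γ).lin
        (fun α => ((Contramodule.contraextension (𝒞.map α).toCoalgHom).map u).lin (m α))
    by_cases h : y ≤ x
    · refine (congrArg _ (exComponent_lin 𝒞 x N β γ (homOfLE h) m)).trans (Eq.trans ?_
        (exComponent_lin 𝒞 x N' β γ (homOfLE h) (fun α =>
          ((Contramodule.contraextension (𝒞.map α).toCoalgHom).map u).lin (m α))).symm)
      exact Contramodule.contraextensionTransition_naturality _ _ _ _ u _
    · rw [exComponent, dif_neg h, exComponent, dif_neg h]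
      exact map_zero _

/-- The functor `ex_x` from `𝒞_x`-contramodules to trans-contramodules over `𝒞`. -/
noncomputable def ex : Contramodule K (𝒞.obj x) ⥤ TransContramodule 𝒞 where
  obj N := exObj 𝒞 x N
  map u := exMap 𝒞 x u
  map_id N := by
    refine Hom.ext (funext fun y => Contramodule.hom_ext (LinearMap.ext fun m => funext fun α => ?_))
    change ((Contramodule.contraextension (𝒞.map α).toCoalgHom).map (𝟙 N)).lin (m α) = m α
    rw [CategoryTheory.Functor.map_id]
    rfl
  map_comp u v := by
    refine Hom.ext (funext fun y => Contramodule.hom_ext (LinearMap.ext fun m => funext fun α => ?_))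
    change ((Contramodule.contraextension (𝒞.map α).toCoalgHom).map (u ≫ v)).lin (m α) = _
    rw [CategoryTheory.Functor.map_comp]
    rfl

end Extension

end TransContramodule

/-!
A contramodule over `C` is an algebra over the monad `Hom_K(C, -)` on vector spaces. Cokernels of
contramodules are formed on the underlying vector spaces, and limits are created there by
monadicity, so contramodules form an abelian category. Since `C^*` is the free contramodule on `K`,
the morphisms out of it are the elements of the underlying vector space.

Colimits of trans-contramodules are componentwise, and over a poset `ex_x` is left adjoint to the
evaluation at `x`. The evaluations preserve colimits and jointly reflect isomorphisms; by Beck's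
theorem, applied to the product of all of them, they jointly create limits, so that being abelian
can be tested componentwise. The morphisms `ex_x(C_x^*) → M` are the elements of `M_x`: this makes
the objects `ex_x(C_x^*)` projective and separating.

As a functor to sets, `Hom_K(C, -)` is represented by `C`. It therefore preserves `κ`-filtered
colimits as soon as `κ` is regular and exceeds the dimension of `C`, in which case `C^*` is
`κ`-presentable; and the left adjoints `ex_x` preserve `κ`-presentability because the evaluations
preserve all colimits.
-/

open CategoryTheory.Limits

section Abelian

universe v v' w w' t

variable {𝒜 : Type w} [Category.{v} 𝒜] [Preadditive 𝒜] {ι : Type t} {ℬ : ι → Type w'}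
  [∀ i, Category.{v'} (ℬ i)] [∀ i, Abelian (ℬ i)] {F : ∀ i, 𝒜 ⥤ ℬ i}

/-- Every `F i` turns the comparison from the coimage to the image into the same comparison in the
abelian category `ℬ i`, where it is an isomorphism. -/
noncomputable abbrev abelianOfJointlyReflectIsomorphisms [HasKernels 𝒜] [HasCokernels 𝒜]
    [HasFiniteProducts 𝒜] [∀ i, (F i).PreservesZeroMorphisms]
    [∀ i, PreservesLimitsOfShape WalkingParallelPair (F i)]
    [∀ i, PreservesColimitsOfShape WalkingParallelPair (F i)]
    (hF : JointlyReflectIsomorphisms F) : Abelian 𝒜 :=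
  have {X Y : 𝒜} (f : X ⟶ Y) : IsIso (Abelian.coimageImageComparison f) := by
    refine (hF.isIso_iff _).2 fun i => ?_
    rw [Arrow.isIso_iff_isIso_of_isIso (Abelian.PreservesCoimageImageComparison.iso (F i) f).hom]
    infer_instance
  .ofCoimageImageComparisonIsIso

end Abelian

theorem hasColimitsOfShape_of_faithful_rightAdjoint {𝒜 : Type*} [Category* 𝒜] [Abelian 𝒜]
    {ℬ : Type*} [Category* ℬ] {L : ℬ ⥤ 𝒜} {U : 𝒜 ⥤ ℬ} (adj : L ⊣ U) [U.Faithful]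
    (J : Type*) [Category* J] [HasColimitsOfShape J ℬ] : HasColimitsOfShape J 𝒜 := by
  have := hasColimitsOfShape_iff_isRightAdjoint_const.1 ‹HasColimitsOfShape J ℬ›
  have := adj.isRightAdjoint
  have epi_counit (G : J ⥤ 𝒜) : Epi ((adj.whiskerRight J).counit.app G) := by
    have (j : J) : Epi (((adj.whiskerRight J).counit.app G).app j) := by
      have := adj.counit_epi_of_R_faithful (G.obj j)
      simpa using this
    exact NatTrans.epi_of_epi_app _
  have : (Functor.const J ⋙ (Functor.whiskeringRight J 𝒜 ℬ).obj U).IsRightAdjoint :=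
    Functor.isRightAdjoint_of_iso (F := U ⋙ Functor.const J) (Functor.compConstIso J U)
  exact hasColimitsOfShape_iff_isRightAdjoint_const.2 <|
    isRightAdjoint_triangle_lift _ (adj.whiskerRight J) fun G =>
      have := epi_counit G
      regularEpiOfEpi _

section Pi

variable {𝒜 : Type*} [Category* 𝒜] {ι : Type*} {ℬ : ι → Type*} [∀ i, Category* (ℬ i)]
  {L : ∀ i, ℬ i ⥤ 𝒜} {R : ∀ i, 𝒜 ⥤ ℬ i}

instance preservesColimitsOfShape_pi' (J : Type*) [Category* J]
    [∀ i, PreservesColimitsOfShape J (R i)] : PreservesColimitsOfShape J (Functor.pi' R) where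
  preservesColimit := ⟨fun hc => ⟨
    { desc s i := (isColimitOfPreserves (R i) hc).desc ((Pi.eval ℬ i).mapCocone s)
      fac s j := funext fun i =>
        (isColimitOfPreserves (R i) hc).fac ((Pi.eval ℬ i).mapCocone s) j
      uniq s f hf := funext fun i =>
        (isColimitOfPreserves (R i) hc).uniq ((Pi.eval ℬ i).mapCocone s) (f i)
          fun j => congrFun (hf j) i }⟩⟩

theorem reflectsIsomorphisms_pi' (hR : JointlyReflectIsomorphisms R) :
    (Functor.pi' R).ReflectsIsomorphisms where
  reflects f _ := (hR.isIso_iff f).2 ((isIso_pi_iff _).1 ‹_›)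

theorem isRightAdjoint_pi' [HasCoproductsOfShape ι 𝒜] (adj : ∀ i, L i ⊣ R i) :
    (Functor.pi' R).IsRightAdjoint :=
  (Adjunction.adjunctionOfEquivLeft (G := Functor.pi' R)
    (F_obj := fun B => ∐ fun i => (L i).obj (B i))
    (fun B A =>
      { toFun f i := (adj i).homEquiv (B i) A (Sigma.ι (fun i => (L i).obj (B i)) i ≫ f)
        invFun g := Sigma.desc fun i => ((adj i).homEquiv (B i) A).symm (g i)
        left_inv _ := Sigma.hom_ext _ _ fun i =>
          (Sigma.ι_desc _ _).trans (((adj i).homEquiv _ _).symm_apply_apply _)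
        right_inv _ := funext fun i =>
          (congrArg _ (Sigma.ι_desc _ _)).trans (((adj i).homEquiv _ _).apply_symm_apply _) })
    fun _ _ _ _ _ => funext fun i =>
      (congrArg _ (Category.assoc _ _ _).symm).trans
        ((adj i).homEquiv_naturality_right _ _)).isRightAdjoint

end Pi

section Limits

universe v w w'

variable {𝒜 : Type w} [Category.{v} 𝒜] {ι : Type v} {ℬ : ι → Type w'} [∀ i, Category.{v} (ℬ i)]
  {L : ∀ i, ℬ i ⥤ 𝒜} {R : ∀ i, 𝒜 ⥤ ℬ i}

/-- By monadicity, the functors `R i` jointly create limits. -/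
theorem hasLimits_of_jointlyReflectIsomorphisms [HasCoproductsOfShape ι 𝒜] [HasCoequalizers 𝒜]
    [∀ i, HasLimits (ℬ i)] [∀ i, PreservesColimitsOfShape WalkingParallelPair (R i)]
    (adj : ∀ i, L i ⊣ R i) (hR : JointlyReflectIsomorphisms R) : HasLimits 𝒜 := by
  have := reflectsIsomorphisms_pi' hR
  have := isRightAdjoint_pi' adj
  have : Monad.PreservesColimitOfIsReflexivePair (Functor.pi' R) := ⟨fun _ _ _ => inferInstance⟩
  let _ : MonadicRightAdjoint (Functor.pi' R) :=
    Monad.monadicOfHasPreservesReflexiveCoequalizersOfReflectsIsomorphisms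
      (Adjunction.ofIsRightAdjoint (Functor.pi' R))
  have : HasLimits (∀ i, ℬ i) := ⟨fun _ _ => ⟨fun _ => pi.hasLimit_of_hasLimit_comp_eval⟩⟩
  have : CreatesLimits (Functor.pi' R) := monadicCreatesLimits _
  exact hasLimits_of_hasLimits_createsLimits (Functor.pi' R)

end Limits

section Presentable

variable {K : Type u} (κ : Cardinal.{u}) [Fact κ.IsRegular]

instance isCardinalAccessible_forget_moduleCat [Ring K] :
    (CategoryTheory.forget (ModuleCat.{u} K)).IsCardinalAccessible κ where
  preservesColimitOfShape J _ _ :=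
    have := isFiltered_of_isCardinalFiltered J κ
    PreservesFilteredColimitsOfSize.preserves_filtered_colimits J

variable {κ} in
theorem isCardinalPresentable_of_basis [Ring K] {V ι : Type u} [AddCommGroup V] [Module K V]
    (b : Module.Basis ι K V) (hι : HasCardinalLT ι κ) :
    IsCardinalPresentable (ModuleCat.of K V) κ :=
  have := hι.isCardinalPresentable
  have := (ModuleCat.adj K).isCardinalPresentable_leftAdjoint_obj κ ι
  isCardinalPresentable_of_iso (X := (ModuleCat.free K).obj ι) b.repr.symm.toModuleIso κ

instance isCardinalPresentable_moduleCat_self [CommRing K] :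
    IsCardinalPresentable (ModuleCat.of K K) κ :=
  isCardinalPresentable_of_basis (Module.Basis.singleton PUnit K)
    (hasCardinalLT_of_finite _ _ (Cardinal.IsRegular.aleph0_le Fact.out))

end Presentable

section Generators

theorem isSeparating_of_adjunctions {𝒜 : Type*} [Category* 𝒜] {ι : Type*} {ℬ : ι → Type*}
    [∀ i, Category* (ℬ i)] {L : ∀ i, ℬ i ⥤ 𝒜} {R : ∀ i, 𝒜 ⥤ ℬ i} (adj : ∀ i, L i ⊣ R i)
    (hR : JointlyFaithful R) {P : ∀ i, ObjectProperty (ℬ i)} (hP : ∀ i, (P i).IsSeparating)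
    {Q : ObjectProperty 𝒜} (hQ : ∀ i, P i ≤ Q.inverseImage (L i)) : Q.IsSeparating :=
  fun _ _ f g h => hR.map_injective fun i => hP i _ _ fun G hG φ => by
    have := h _ (hQ i G hG) (((adj i).homEquiv _ _).symm φ)
    simpa [Adjunction.homEquiv_naturality_right] using congrArg ((adj i).homEquiv _ _) this

theorem isStrongGenerator_of_isSeparating {𝒜 : Type*} [Category* 𝒜] [Balanced 𝒜]
    {P : ObjectProperty 𝒜} (hP : P.IsSeparating) : P.IsStrongGenerator := by
  refine ObjectProperty.isStrongGenerator_iff.2 ⟨hP, fun Y Z i _ hi => ?_⟩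
  refine hP.isDetecting i fun G hG φ => ?_
  obtain ⟨ψ, hψ⟩ := hi G hG φ
  exact ⟨ψ, hψ, fun ψ' hψ' => (cancel_mono i).1 (hψ'.trans hψ.symm)⟩

theorem isSeparator_moduleCat_self (K : Type u) [Ring K] : IsSeparator (ModuleCat.of K K) :=
  fun V _ f g h => ModuleCat.hom_ext <| LinearMap.ext fun v => by
    have := h _ ⟨()⟩ (ModuleCat.ofHom (LinearMap.toSpanSingleton K V v))
    simpa using ConcreteCategory.congr_hom this 1

end Generators

namespace Contramodule

variable {K : Type u} [Field K] {C : Type u} [AddCommGroup C] [Module K C] [Coalgebra K C]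

section Free

variable {V W : Type u} [AddCommGroup V] [Module K V] [AddCommGroup W] [Module K W]
  {M : Contramodule K C}

variable (C V) in
/-- The unit `v ↦ (c ↦ ε(c) v)` of the monad `Hom_K(C, -)` on vector spaces. -/
noncomputable def unit : V →ₗ[K] C →ₗ[K] V :=
  LinearMap.lcomp K V Coalgebra.counit ∘ₗ (LinearMap.ringLmapEquivSelf K K V).symm.toLinearMap

theorem unit_apply (v : V) :
    unit C V v = LinearMap.toSpanSingleton K V v ∘ₗ Coalgebra.counit := by
  ext
  simp [unit]

theorem unit_apply_apply (v : V) (c : C) :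
    (unit C V v : C →ₗ[K] V) c = (Coalgebra.counit c : K) • v := by
  simp [unit]

theorem π_unit (m : M.carrier) : M.π (unit C M.carrier m) = m := by
  rw [unit_apply, M.contra_counit]

theorem comp_unit (u : V →ₗ[K] W) (v : V) : u ∘ₗ unit C V v = unit C W (u v) := by
  ext c
  simp [unit_apply_apply]

theorem freeπ_unit_comp (f : C →ₗ[K] V) : freeπ C V (unit C V ∘ₗ f) = f := by
  have h : TensorProduct.lift (unit C V ∘ₗ f) =
      TensorProduct.lift (LinearMap.lsmul K V).flip ∘ₗ LinearMap.rTensor K f ∘ₗ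
        LinearMap.lTensor C Coalgebra.counit := by
    ext a b
    simp [unit_apply_apply]
  ext c
  rw [freeπ_eq, h]
  simp only [LinearMap.comp_apply, Coalgebra.lTensor_counit_comul]
  simp

/-- The morphism of contramodules `Hom_K(C, V) → M` that extends a linear map `V → M`. -/
noncomputable def freeDesc (u : V →ₗ[K] M.carrier) : free K C V ⟶ M where
  lin := M.π ∘ₗ LinearMap.compRight K u
  comm g := by
    have h : u ∘ₗ TensorProduct.lift g = TensorProduct.lift (LinearMap.compRight K u ∘ₗ g) :=
      TensorProduct.ext' fun a b => rfl
    change M.π (u ∘ₗ TensorProduct.lift g ∘ₗ Coalgebra.comul) =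
      M.π (M.π ∘ₗ LinearMap.compRight K u ∘ₗ g)
    rw [M.contra_assoc, ← h, LinearMap.comp_assoc]

theorem freeDesc_lin_apply (u : V →ₗ[K] M.carrier) (f : C →ₗ[K] V) :
    (freeDesc u).lin f = M.π (u ∘ₗ f) := rfl

theorem freeDesc_lin_unit (u : V →ₗ[K] M.carrier) (v : V) :
    (freeDesc u).lin (unit C V v) = u v := by
  rw [freeDesc_lin_apply, comp_unit, π_unit]

theorem free_hom_ext {φ ψ : free K C V ⟶ M}
    (h : ∀ v, φ.lin (unit C V v) = ψ.lin (unit C V v)) : φ = ψ := by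
  have lin_eq (χ : free K C V ⟶ M) (f : C →ₗ[K] V) :
      χ.lin f = M.π (χ.lin ∘ₗ unit C V ∘ₗ f) :=
    (congrArg χ.lin (freeπ_unit_comp f).symm).trans (χ.comm (unit C V ∘ₗ f))
  exact hom_ext <| LinearMap.ext fun f : C →ₗ[K] V => (lin_eq φ f).trans <|
    (congrArg M.π (LinearMap.ext fun c => h (f c))).trans (lin_eq ψ f).symm

variable (K C) in
/-- The forgetful functor from contramodules to vector spaces. -/
def forget : Contramodule K C ⥤ ModuleCat.{u} K where
  obj M := ModuleCat.of K M.carrier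
  map f := ModuleCat.ofHom f.lin

/-- The bijection between the morphisms out of the free contramodule on `V` and the linear maps
out of `V`. -/
noncomputable def freeHomEquiv (V : ModuleCat.{u} K) (M : Contramodule K C) :
    (free K C V ⟶ M) ≃ (V ⟶ (forget K C).obj M) where
  toFun φ := ModuleCat.ofHom (φ.lin ∘ₗ unit C V)
  invFun u := freeDesc u.hom
  left_inv _ := free_hom_ext (freeDesc_lin_unit _)
  right_inv u := ModuleCat.hom_ext (LinearMap.ext (freeDesc_lin_unit u.hom))

variable (K C) in
/-- The functor that takes a vector space `V` to the free contramodule `Hom_K(C, V)`. -/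
noncomputable def freeFunctor : ModuleCat.{u} K ⥤ Contramodule K C :=
  Adjunction.leftAdjointOfEquiv (G := forget K C) freeHomEquiv fun _ _ _ _ _ => rfl

variable (K C) in
/-- Free contramodules are left adjoint to the forgetful functor. -/
noncomputable def freeAdjunction : freeFunctor K C ⊣ forget K C :=
  Adjunction.adjunctionOfEquivLeft freeHomEquiv fun _ _ _ _ _ => rfl

end Free

instance : (forget K C).Faithful where
  map_injective h := hom_ext (congrArg ModuleCat.Hom.hom h)

instance : (forget K C).ReflectsIsomorphisms where
  reflects {M N} f _ := by
    let e : M.carrier ≃ₗ[K] N.carrier := (asIso ((forget K C).map f)).toLinearEquiv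
    have he (m : M.carrier) : e m = f.lin m := rfl
    let g : N ⟶ M :=
      { lin := e.symm
        comm h := by
          apply e.injective
          rw [LinearEquiv.coe_coe, e.apply_symm_apply, he, f.comm]
          exact congrArg N.π (LinearMap.ext fun c => (e.apply_symm_apply (h c)).symm) }
    exact ⟨g, hom_ext (LinearMap.ext e.symm_apply_apply),
      hom_ext (LinearMap.ext e.apply_symm_apply)⟩

section Preadditive

/-- The additive group of linear maps that commute with the contractions. -/
def homAddSubgroup (M N : Contramodule K C) : AddSubgroup (M.carrier →ₗ[K] N.carrier) where
  carrier := {u | ∀ f, u (M.π f) = N.π (u ∘ₗ f)}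
  zero_mem' _ := by simp
  add_mem' hu hv f := by simp [hu f, hv f, LinearMap.add_comp]
  neg_mem' hu f := by simp [hu f, LinearMap.neg_comp]

/-- The morphisms of contramodules as a subgroup of the linear maps, along which their additive
structure is transported. -/
def homEquiv (M N : Contramodule K C) : (M ⟶ N) ≃ homAddSubgroup M N where
  toFun u := ⟨u.lin, u.comm⟩
  invFun u := ⟨u.1, u.2⟩

noncomputable instance (M N : Contramodule K C) : AddCommGroup (M ⟶ N) :=
  (homEquiv M N).addCommGroup

theorem zero_lin (M N : Contramodule K C) : (0 : M ⟶ N).lin = 0 := rfl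

theorem add_lin {M N : Contramodule K C} (u v : M ⟶ N) : (u + v).lin = u.lin + v.lin := rfl

noncomputable instance : Preadditive (Contramodule K C) where
  add_comp _ _ _ u v w := hom_ext <| by
    simp only [comp_lin, add_lin, LinearMap.comp_add]
  comp_add _ _ _ u v w := hom_ext <| by
    simp only [comp_lin, add_lin, LinearMap.add_comp]

instance : (forget K C).Additive where
  map_add := rfl

end Preadditive

section Quotient

variable {M N P : Contramodule K C}

theorem π_mem_range (u : M ⟶ N) (f : C →ₗ[K] N.carrier) (hf : ∀ c, f c ∈ LinearMap.range u.lin) :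
    N.π f ∈ LinearMap.range u.lin := by
  obtain ⟨s, hs⟩ := u.lin.rangeRestrict.exists_rightInverse_of_surjective u.lin.range_rangeRestrict
  have hs' (n : LinearMap.range u.lin) : u.lin (s n) = n :=
    congrArg Subtype.val (LinearMap.congr_fun hs n)
  refine ⟨M.π (s ∘ₗ f.codRestrict _ hf), (u.comm _).trans (congrArg N.π ?_)⟩
  exact LinearMap.ext fun c => hs' _

variable (R : Submodule K M.carrier) (hR : ∀ f : C →ₗ[K] M.carrier, (∀ c, f c ∈ R) → M.π f ∈ R)

/-- The projection onto the quotient by a subcontramodule. -/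
noncomputable def quotientMk : M ⟶ M.quotient R hR where
  lin := R.mkQ
  comm f := (quotientπ_mkQ_comp M R hR f).symm

variable {R} in
/-- The morphism out of the quotient by a subcontramodule induced by a morphism that vanishes on
it. -/
noncomputable def quotientDesc (u : M ⟶ N) (hu : R ≤ LinearMap.ker u.lin) :
    M.quotient R hR ⟶ N where
  lin := R.liftQ u.lin hu
  comm f := by
    obtain ⟨f, rfl⟩ := exists_lift R f
    refine (congrArg (R.liftQ u.lin hu) (quotientπ_mkQ_comp M R hR f)).trans ?_
    exact (u.comm f).trans (congrArg N.π rfl)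

variable {R} in
theorem quotient_hom_ext {u v : M.quotient R hR ⟶ N}
    (h : quotientMk R hR ≫ u = quotientMk R hR ≫ v) : u = v :=
  hom_ext (Submodule.linearMap_qext R (congrArg Hom.lin h))

end Quotient

section Cokernel

variable {M N : Contramodule K C} (u : M ⟶ N)

/-- The cokernel of a morphism of contramodules, computed on the underlying vector spaces. -/
noncomputable abbrev cokernelCofork : CokernelCofork u :=
  CokernelCofork.ofπ (quotientMk (LinearMap.range u.lin) (π_mem_range u))
    (hom_ext u.lin.range_mkQ_comp)

noncomputable def isColimitCokernelCofork : IsColimit (cokernelCofork u) :=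
  CokernelCofork.IsColimit.ofπ _ _
    (fun v hv => quotientDesc (π_mem_range u) v
      (LinearMap.range_le_ker_iff.2 ((congrArg Hom.lin hv).trans (zero_lin _ _))))
    (fun _ _ => rfl) fun _ _ _ h => quotient_hom_ext _ h

instance : HasCokernels (Contramodule K C) where
  has_colimit u := ⟨⟨_, isColimitCokernelCofork u⟩⟩

instance : HasCoequalizers (Contramodule K C) :=
  Preadditive.hasCoequalizers_of_hasCokernels

instance : PreservesColimit (parallelPair u 0) (forget K C) :=
  preservesColimit_of_preserves_colimit_cocone (isColimitCokernelCofork u) <|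
    (CokernelCofork.isColimitMapCoconeEquiv _ _).2
      (ModuleCat.cokernelIsColimit (ModuleCat.ofHom u.lin))

end Cokernel

instance : HasProducts.{u} (Contramodule K C) :=
  hasProducts_of_limit_fans (fun M => Fan.mk (pi M) (proj M)) fun _ =>
    Fan.IsLimit.mk _
      (fun s =>
        { lin := LinearMap.pi fun i => (s.proj i).lin
          comm f := funext fun i => (s.proj i).comm f })
      (fun _ _ => rfl)
      fun _ _ h => hom_ext (LinearMap.ext fun m => funext fun i =>
        LinearMap.congr_fun (congrArg Hom.lin (h i)) m)

instance : HasBinaryBiproducts (Contramodule K C) :=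
  have := hasFiniteProducts_of_hasProducts (Contramodule K C)
  HasBinaryBiproducts.of_hasBinaryProducts

instance : PreservesColimitsOfShape WalkingParallelPair (forget K C) :=
  Functor.preservesCoequalizers_of_preservesCokernels _

noncomputable instance : MonadicRightAdjoint (forget K C) :=
  have : Monad.PreservesColimitOfIsReflexivePair (forget K C) := ⟨fun _ _ _ => inferInstance⟩
  Monad.monadicOfHasPreservesReflexiveCoequalizersOfReflectsIsomorphisms (freeAdjunction K C)

noncomputable instance : CreatesLimits (forget K C) :=
  monadicCreatesLimits _

instance : HasLimits (Contramodule K C) :=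
  hasLimits_of_hasLimits_createsLimits (forget K C)

noncomputable instance : Abelian (Contramodule K C) :=
  abelianOfJointlyReflectIsomorphisms (F := fun _ : Unit => forget K C)
    ⟨fun f hf => have := hf (); isIso_of_reflects_iso f (forget K C)⟩

instance : HasColimits (Contramodule K C) where
  has_colimits_of_shape J := hasColimitsOfShape_of_faithful_rightAdjoint (freeAdjunction K C) J

theorem isIso_of_bijective {M N : Contramodule K C} (f : M ⟶ N)
    (hf : Function.Bijective f.lin) : IsIso f :=
  have : IsIso ((forget K C).map f) := (ConcreteCategory.isIso_iff_bijective _).2 hf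
  isIso_of_reflects_iso f (forget K C)

variable (K C) in
theorem isSeparator_dual : IsSeparator (dual K C) :=
  isSeparating_of_adjunctions (fun _ : Unit => freeAdjunction K C)
    ⟨fun h => (forget K C).map_injective (h ())⟩ (fun _ => isSeparator_moduleCat_self K) fun _ => by
      rintro _ ⟨_⟩
      exact ⟨()⟩

instance : Projective (dual K C) :=
  have : (forget K C).PreservesEpimorphisms :=
    NormalMonoCategory.preservesEpimorphisms_of_preservesCokernels _
  (freeAdjunction K C).map_projective (ModuleCat.of K K) inferInstance

section Presentable

variable (κ : Cardinal.{u}) [Fact κ.IsRegular]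

theorem freeFunctor_map_lin_apply {V W : ModuleCat.{u} K} (u : V ⟶ W) (f : C →ₗ[K] V) :
    ((freeFunctor K C).map u).lin f = u.hom ∘ₗ f :=
  freeπ_unit_comp (u.hom ∘ₗ f)

variable (K C) in
/-- As a functor to sets, the monad of free contramodules is represented by the coalgebra. -/
noncomputable def freeCompForgetIso : freeFunctor K C ⋙ forget K C ⋙ CategoryTheory.forget _ ≅
    coyoneda.obj (.op (ModuleCat.of K C)) :=
  NatIso.ofComponents
    (fun V => (ModuleCat.homEquiv (M := ModuleCat.of K C) (N := V)).symm.toIso)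
    fun u => by
      ext f
      exact congrArg ModuleCat.ofHom (freeFunctor_map_lin_apply u f)

instance [IsCardinalPresentable (ModuleCat.of K C) κ] :
    (freeFunctor K C ⋙ forget K C).IsCardinalAccessible κ where
  preservesColimitOfShape J _ _ :=
    have := preservesColimitsOfShape_of_isCardinalPresentable (ModuleCat.of K C) κ J
    have := isFiltered_of_isCardinalFiltered J κ
    have := reflectsColimitsOfShape_of_reflectsIsomorphisms (J := J)
      (G := CategoryTheory.forget (ModuleCat.{u} K))
    have : PreservesColimitsOfShape J
      ((freeFunctor K C ⋙ forget K C) ⋙ CategoryTheory.forget (ModuleCat.{u} K)) :=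
      preservesColimitsOfShape_of_natIso (freeCompForgetIso K C).symm
    preservesColimitsOfShape_of_reflects_of_preserves _ (CategoryTheory.forget (ModuleCat.{u} K))

instance [IsCardinalPresentable (ModuleCat.of K C) κ] : (forget K C).IsCardinalAccessible κ where
  preservesColimitOfShape J _ _ :=
    have : PreservesColimitsOfShape J (monadicLeftAdjoint (forget K C) ⋙ forget K C) :=
      (freeFunctor K C ⋙ forget K C).preservesColimitsOfShape_of_isCardinalAccessible κ J
    have (F : J ⥤ Contramodule K C) : CreatesColimit F (forget K C) :=
      monadicCreatesColimitOfPreservesColimit _ F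
    ⟨inferInstance⟩

instance [IsCardinalPresentable (ModuleCat.of K C) κ] : IsCardinalPresentable (dual K C) κ :=
  (freeAdjunction K C).isCardinalPresentable_leftAdjoint_obj κ (ModuleCat.of K K)

theorem exists_isCardinalPresentable_dual {X : Type u} (𝒞 : X → CoalgCat.{u} K) :
    ∃ (κ : Cardinal.{u}) (_ : Fact κ.IsRegular),
      ∀ x, IsCardinalPresentable (dual K (𝒞 x)) κ := by
  obtain ⟨κ, hκ, h⟩ := HasCardinalLT.exists_regular_cardinal_forall fun x =>
    Module.Basis.ofVectorSpaceIndex K (𝒞 x)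
  have : Fact κ.IsRegular := ⟨hκ⟩
  refine ⟨κ, this, fun x => ?_⟩
  have := isCardinalPresentable_of_basis (Module.Basis.ofVectorSpace K (𝒞 x)) (h x)
  infer_instance

end Presentable

section Contraextension

variable {D : Type u} [AddCommGroup D] [Module K D] [Coalgebra K D]
  (α : C →ₗc[K] D) {N : Contramodule K D} {M : Contramodule K C}

theorem cohomRel_unit_comp (f : D →ₗ[K] N.carrier) :
    cohomRel α N (unit C _ f) = unit C _ (N.π f) - f ∘ₗ α.toLinearMap := by
  have h : LinearMap.lcomp K N.carrier α.toLinearMap ∘ₗ unit C _ f =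
      unit C _ (f ∘ₗ α.toLinearMap) := comp_unit _ _
  rw [cohomRel_apply, comp_unit, lift_comp_rightCoaction, h]
  exact congrArg (unit C _ (N.π f) - ·) (π_unit (M := free K C N.carrier) _)

variable (N) in
/-- The unit `N → α_• α^• N` of the contraextension of scalars, which takes `n` to the class of
`c ↦ ε(c) n`. -/
noncomputable def contraextensionUnit :
    N ⟶ (contrarestriction α).obj ((contraextension α).obj N) where
  lin := (LinearMap.range (cohomRel α N)).mkQ ∘ₗ unit C N.carrier
  comm f := by
    refine Eq.trans ?_ (contraextensionObj_π_mkQ α N (unit C _ ∘ₗ f ∘ₗ α.toLinearMap)).symm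
    rw [freeπ_unit_comp]
    exact (Submodule.Quotient.eq _).2 ⟨unit C _ f, cohomRel_unit_comp α f⟩

theorem freeDesc_cohomRel (u : N ⟶ (contrarestriction α).obj M)
    (g : C →ₗ[K] D →ₗ[K] N.carrier) :
    (freeDesc (M := M) u.lin).lin (cohomRel α N g) = 0 := by
  let φ : free K C N.carrier ⟶ M := freeDesc (M := M) u.lin
  have h : φ.lin (N.π ∘ₗ g) = φ.lin (freeπ C _ (LinearMap.lcomp K _ α.toLinearMap ∘ₗ g)) :=
    (congrArg M.π (LinearMap.ext fun c => u.comm (g c))).trans (φ.comm _).symm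
  rw [cohomRel_apply, lift_comp_rightCoaction]
  exact (map_sub φ.lin _ _).trans (sub_eq_zero.2 h)

/-- The morphism `α^• N → M` that corresponds to a morphism `N → α_• M`. -/
noncomputable def contraextensionDesc (u : N ⟶ (contrarestriction α).obj M) :
    (contraextension α).obj N ⟶ M :=
  quotientDesc (range_cohomRel_closed α N) (freeDesc (M := M) u.lin)
    (LinearMap.range_le_ker_iff.2 (LinearMap.ext (freeDesc_cohomRel α u)))

theorem contraextensionDesc_lin_unit (u : N ⟶ (contrarestriction α).obj M) (n : N.carrier) :
    (contraextensionDesc α u).lin ((contraextensionUnit α N).lin n) = u.lin n :=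
  freeDesc_lin_unit (M := M) u.lin n

variable {α} in
theorem contraextension_hom_ext {φ ψ : (contraextension α).obj N ⟶ M}
    (h : ∀ n, φ.lin ((contraextensionUnit α N).lin n) =
      ψ.lin ((contraextensionUnit α N).lin n)) : φ = ψ :=
  quotient_hom_ext (range_cohomRel_closed α N) (free_hom_ext h)

end Contraextension

section Contrarestriction

variable {B D : Type u} [AddCommGroup B] [Module K B] [Coalgebra K B]
  [AddCommGroup D] [Module K D] [Coalgebra K D]

/-- The identity map, as a morphism from the contrarestriction of `M` along the identity to `M`. -/
def contrarestrictionId {ε : C →ₗc[K] C} (hε : ε.toLinearMap = LinearMap.id)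
    (M : Contramodule K C) : (contrarestriction ε).obj M ⟶ M where
  lin := LinearMap.id
  comm f := congrArg M.π (LinearMap.ext fun c => congrArg f (LinearMap.congr_fun hε c))

/-- The identity map, as a morphism from an iterated contrarestriction to the contrarestriction
along the composite. -/
def contrarestrictionComp {α : B →ₗc[K] C} {β : C →ₗc[K] D} {γ : B →ₗc[K] D}
    (hγ : γ.toLinearMap = β.toLinearMap ∘ₗ α.toLinearMap) (M : Contramodule K B) :
    (contrarestriction β).obj ((contrarestriction α).obj M) ⟶ (contrarestriction γ).obj M where
  lin := LinearMap.id
  comm f := congrArg M.π (LinearMap.ext fun c => congrArg f (LinearMap.congr_fun hγ.symm c))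

end Contrarestriction

end Contramodule

namespace TransContramodule

section

variable {K : Type u} [Field K] {X : Type u} [SmallCategory X] {𝒞 : X ⥤ CoalgCat.{u} K}

theorem toLinearMap_map_id (𝒞 : X ⥤ CoalgCat.{u} K) (x : X) :
    (𝒞.map (𝟙 x)).toCoalgHom.toLinearMap = LinearMap.id := by
  rw [CategoryTheory.Functor.map_id]
  rfl

theorem toLinearMap_map_comp (𝒞 : X ⥤ CoalgCat.{u} K) {x y z : X} (α : x ⟶ y) (β : y ⟶ z) :
    (𝒞.map (α ≫ β)).toCoalgHom.toLinearMap =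
      (𝒞.map β).toCoalgHom.toLinearMap ∘ₗ (𝒞.map α).toCoalgHom.toLinearMap := by
  rw [CategoryTheory.Functor.map_comp]
  rfl

theorem app_map {M N : TransContramodule 𝒞} (f : M ⟶ N) {x y : X} (α : x ⟶ y)
    (m : (M.obj y).carrier) :
    (f.app x).lin ((M.map α).lin m) = (N.map α).lin ((f.app y).lin m) :=
  LinearMap.congr_fun (congrArg Contramodule.Hom.lin (f.naturality α)) m

variable (𝒞) in
/-- The functor that takes a trans-contramodule to its component at an object. -/
def eval (x : X) : TransContramodule 𝒞 ⥤ Contramodule K (𝒞.obj x) where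
  obj M := M.obj x
  map f := f.app x

variable (𝒞) in
theorem jointlyFaithful_eval : JointlyFaithful (eval 𝒞) where
  map_injective h := Hom.ext (funext h)

variable (𝒞) in
theorem jointlyReflectIsomorphisms_eval : JointlyReflectIsomorphisms (eval 𝒞) where
  isIso {M N} f hf := by
    let e (x : X) : M.obj x ≅ N.obj x := @asIso _ _ _ _ _ (hf x)
    let g : N ⟶ M :=
      { app x := (e x).inv
        naturality {x y} α :=
          let F := Contramodule.contrarestriction (𝒞.map α).toCoalgHom
          (CommSq.vert_inv (g := e y) (h := F.mapIso (e x)) ⟨f.naturality α⟩).w }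
    exact ⟨g, Hom.ext (funext fun x => (e x).hom_inv_id),
      Hom.ext (funext fun x => (e x).inv_hom_id)⟩

section Preadditive

/-- The additive group of families of morphisms of contramodules that are compatible with the
structure morphisms. -/
noncomputable def homAddSubgroup (M N : TransContramodule 𝒞) :
    AddSubgroup (∀ x, M.obj x ⟶ N.obj x) where
  carrier := {f | ∀ (x y : X) (α : x ⟶ y),
    M.map α ≫ (Contramodule.contrarestriction (𝒞.map α).toCoalgHom).map (f x) = f y ≫ N.map α}
  zero_mem' _ _ α := (comp_zero (f := M.map α)).trans zero_comp.symm
  add_mem' {f g} hf hg x y α := by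
    rw [Pi.add_apply, Pi.add_apply, Preadditive.add_comp, ← hf, ← hg, ← Preadditive.comp_add]
    rfl
  neg_mem' {f} hf x y α := by
    rw [Pi.neg_apply, Pi.neg_apply, Preadditive.neg_comp, ← hf, ← Preadditive.comp_neg]
    rfl

/-- The morphisms of trans-contramodules as a subgroup of the families of morphisms, along which
their additive structure is transported. -/
noncomputable def homEquiv (M N : TransContramodule 𝒞) : (M ⟶ N) ≃ homAddSubgroup M N where
  toFun f := ⟨f.app, fun _ _ α => f.naturality α⟩
  invFun f := ⟨f.1, f.2 _ _⟩

noncomputable instance (M N : TransContramodule 𝒞) : AddCommGroup (M ⟶ N) :=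
  (homEquiv M N).addCommGroup

noncomputable instance : Preadditive (TransContramodule 𝒞) where
  add_comp _ _ _ _ _ _ := Hom.ext (funext fun _ => Preadditive.add_comp _ _ _ _ _ _)
  comp_add _ _ _ _ _ _ := Hom.ext (funext fun _ => Preadditive.comp_add _ _ _ _ _ _)

instance (x : X) : (eval 𝒞 x).Additive where
  map_add := rfl

end Preadditive

section Colimits

variable {J : Type u} [SmallCategory J] (F : J ⥤ TransContramodule 𝒞)

/-- The structure morphisms of a diagram of trans-contramodules, as a natural transformation. -/
noncomputable def mapNatTrans {x y : X} (α : x ⟶ y) : F ⋙ eval 𝒞 y ⟶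
    (F ⋙ eval 𝒞 x) ⋙ Contramodule.contrarestriction (𝒞.map α).toCoalgHom where
  app j := (F.obj j).map α
  naturality _ _ φ := ((F.map φ).naturality α).symm

/-- The structure morphisms of a colimit of trans-contramodules. -/
noncomputable def colimitMap {x y : X} (α : x ⟶ y) : colimit (F ⋙ eval 𝒞 y) ⟶
    (Contramodule.contrarestriction (𝒞.map α).toCoalgHom).obj (colimit (F ⋙ eval 𝒞 x)) :=
  colimMap (mapNatTrans F α) ≫ colimit.post _ _

theorem ι_colimitMap {x y : X} (α : x ⟶ y) (j : J) :
    colimit.ι (F ⋙ eval 𝒞 y) j ≫ colimitMap F α = (F.obj j).map α ≫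
      (Contramodule.contrarestriction (𝒞.map α).toCoalgHom).map
        (colimit.ι (F ⋙ eval 𝒞 x) j) := by
  rw [colimitMap, ι_colimMap_assoc, colimit.ι_post]
  rfl

theorem colimitMap_lin_ι {x y : X} (α : x ⟶ y) (j : J) (m : ((F.obj j).obj y).carrier) :
    (colimitMap F α).lin ((colimit.ι (F ⋙ eval 𝒞 y) j).lin m) =
      (colimit.ι (F ⋙ eval 𝒞 x) j).lin (((F.obj j).map α).lin m) :=
  LinearMap.congr_fun (congrArg Contramodule.Hom.lin (ι_colimitMap F α j)) m

/-- The colimit of a diagram of trans-contramodules, computed componentwise. -/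
noncomputable def colimitObj : TransContramodule 𝒞 where
  obj x := colimit (F ⋙ eval 𝒞 x)
  map α := colimitMap F α
  map_id x := by
    have h : colimitMap F (𝟙 x) ≫ Contramodule.contrarestrictionId (toLinearMap_map_id 𝒞 x) _ =
        𝟙 _ :=
      colimit.hom_ext fun j => Contramodule.hom_ext <| LinearMap.ext fun m =>
        (colimitMap_lin_ι F (𝟙 x) j m).trans
          (congrArg (colimit.ι (F ⋙ eval 𝒞 x) j).lin ((F.obj j).map_id x m))
    exact LinearMap.congr_fun (congrArg Contramodule.Hom.lin h)
  map_comp {x y z} α β := by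
    have h : colimitMap F (α ≫ β) = colimitMap F β ≫
        (Contramodule.contrarestriction (𝒞.map β).toCoalgHom).map (colimitMap F α) ≫
          Contramodule.contrarestrictionComp (toLinearMap_map_comp 𝒞 α β) _ :=
      colimit.hom_ext fun j => Contramodule.hom_ext <| LinearMap.ext fun m =>
        (colimitMap_lin_ι F (α ≫ β) j m).trans <|
          (congrArg (colimit.ι (F ⋙ eval 𝒞 x) j).lin ((F.obj j).map_comp α β m)).trans <|
            (colimitMap_lin_ι F α j _).symm.trans
              (congrArg (colimitMap F α).lin (colimitMap_lin_ι F β j m).symm)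
    exact LinearMap.congr_fun (congrArg Contramodule.Hom.lin h)

/-- The colimit cocone of a diagram of trans-contramodules, computed componentwise. -/
noncomputable def colimitCocone : Cocone F where
  pt := colimitObj F
  ι :=
    { app j :=
        { app x := colimit.ι (F ⋙ eval 𝒞 x) j
          naturality α := (ι_colimitMap F α j).symm }
      naturality _ _ φ := Hom.ext <| funext fun x =>
        (colimit.cocone (F ⋙ eval 𝒞 x)).ι.naturality φ }

theorem colimit_desc_lin_ι (s : Cocone F) (x : X) (j : J) (m : ((F.obj j).obj x).carrier) :
    (colimit.desc (F ⋙ eval 𝒞 x) ((eval 𝒞 x).mapCocone s)).lin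
      ((colimit.ι (F ⋙ eval 𝒞 x) j).lin m) = ((s.ι.app j).app x).lin m :=
  LinearMap.congr_fun (congrArg Contramodule.Hom.lin
    (colimit.ι_desc ((eval 𝒞 x).mapCocone s) j)) m

noncomputable def isColimitColimitCocone : IsColimit (colimitCocone F) where
  desc s :=
    { app x := colimit.desc (F ⋙ eval 𝒞 x) ((eval 𝒞 x).mapCocone s)
      naturality {x y} α := colimit.hom_ext fun j => Contramodule.hom_ext <|
        LinearMap.ext fun m =>
          (congrArg (colimit.desc (F ⋙ eval 𝒞 x) ((eval 𝒞 x).mapCocone s)).lin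
            (colimitMap_lin_ι F α j m)).trans <|
              (colimit_desc_lin_ι F s x j _).trans <| (app_map (s.ι.app j) α m).trans <|
                congrArg (s.pt.map α).lin (colimit_desc_lin_ι F s y j m).symm }
  fac s j := Hom.ext (funext fun x => colimit.ι_desc ((eval 𝒞 x).mapCocone s) j)
  uniq s _ hφ := Hom.ext (funext fun x => colimit.hom_ext fun j =>
    (congrArg (fun ψ => ψ.app x) (hφ j)).trans
      (colimit.ι_desc ((eval 𝒞 x).mapCocone s) j).symm)

instance : HasColimits (TransContramodule 𝒞) where
  has_colimits_of_shape _ _ := ⟨fun F => ⟨⟨_, isColimitColimitCocone F⟩⟩⟩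

instance (x : X) : PreservesColimits (eval 𝒞 x) where
  preservesColimitsOfShape := ⟨fun {F} =>
    preservesColimit_of_preserves_colimit_cocone (isColimitColimitCocone F)
      ((colimit.isColimit (F ⋙ eval 𝒞 x)).ofIsoColimit (Cocone.ext (Iso.refl _)))⟩

end Colimits

end

section Extension

variable {K : Type u} [Field K] {X : Type u} [PartialOrder X] (𝒞 : X ⥤ CoalgCat.{u} K) (x : X)
  (N : Contramodule K (𝒞.obj x))

/-- The unit `N → ex_x(N)_x` of the adjunction between `ex_x` and the evaluation at `x`. -/
noncomputable def exUnit : N ⟶ (exObj 𝒞 x N).obj x where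
  lin := LinearMap.pi fun α : x ⟶ x =>
    (Contramodule.contraextensionUnit (𝒞.map α).toCoalgHom N).lin
  comm f := funext fun α => by
    obtain rfl : α = 𝟙 x := Subsingleton.elim _ _
    exact (Contramodule.contraextensionUnit (𝒞.map (𝟙 x)).toCoalgHom N ≫
      Contramodule.contrarestrictionId (toLinearMap_map_id 𝒞 x) _).comm f

theorem map_exUnit {y : X} (α β : y ⟶ x) (n : N.carrier) :
    ((exObj 𝒞 x N).map α).lin ((exUnit 𝒞 x N).lin n) β =
      (Contramodule.contraextensionUnit (𝒞.map β).toCoalgHom N).lin n := by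
  refine (exComponent_lin 𝒞 x N α β (𝟙 x) _).trans ?_
  refine congrArg (Submodule.mkQ _) (LinearMap.ext fun c => ?_)
  exact congrArg (· • n) (CoalgHomClass.counit_comp_apply (𝒞.map α).toCoalgHom c)

variable {𝒞 x N}

instance {y : X} (α : y ⟶ x) : IsIso (Contramodule.proj (fun α : y ⟶ x =>
    (Contramodule.contraextension (𝒞.map α).toCoalgHom).obj N) α) :=
  Contramodule.isIso_of_bijective _ (proj_bijective 𝒞 x N α)

theorem ex_hom_ext {M : TransContramodule 𝒞} {f g : exObj 𝒞 x N ⟶ M}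
    (h : ∀ n, (f.app x).lin ((exUnit 𝒞 x N).lin n) = (g.app x).lin ((exUnit 𝒞 x N).lin n)) :
    f = g := by
  refine Hom.ext (funext fun y => ?_)
  by_cases hy : y ≤ x
  · let p := Contramodule.proj (fun α : y ⟶ x =>
      (Contramodule.contraextension (𝒞.map α).toCoalgHom).obj N) (homOfLE hy)
    have hp (n : N.carrier) : (inv p).lin
        ((Contramodule.contraextensionUnit (𝒞.map (homOfLE hy)).toCoalgHom N).lin n) =
          ((exObj 𝒞 x N).map (homOfLE hy)).lin ((exUnit 𝒞 x N).lin n) := by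
      rw [← map_exUnit 𝒞 x N (homOfLE hy)]
      exact LinearMap.congr_fun (congrArg Contramodule.Hom.lin (IsIso.hom_inv_id p))
        (((exObj 𝒞 x N).map (homOfLE hy)).lin ((exUnit 𝒞 x N).lin n))
    refine (cancel_epi (inv p)).1 (Contramodule.contraextension_hom_ext fun n => ?_)
    change (f.app y).lin ((inv p).lin _) = (g.app y).lin ((inv p).lin _)
    rw [hp, app_map, app_map, h]
  · have : Subsingleton ((exObj 𝒞 x N).obj y).carrier := exValue_subsingleton 𝒞 x N hy
    exact Contramodule.hom_ext (Subsingleton.elim _ _)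

open Classical in
/-- The components of the morphism `ex_x(N) → M` that corresponds to a morphism `N → M_x`. -/
noncomputable def exDescApp {M : TransContramodule 𝒞} (u : N ⟶ M.obj x) (y : X) :
    exValue 𝒞 x N y ⟶ M.obj y :=
  if h : y ≤ x then
    Contramodule.proj _ (homOfLE h) ≫
      Contramodule.contraextensionDesc (𝒞.map (homOfLE h)).toCoalgHom (u ≫ M.map (homOfLE h))
  else Contramodule.zeroHom _ _

theorem exDescApp_lin {M : TransContramodule 𝒞} (u : N ⟶ M.obj x) {y : X} (α : y ⟶ x)
    (m : (exValue 𝒞 x N y).carrier) :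
    (exDescApp u y).lin m =
      (Contramodule.contraextensionDesc (𝒞.map α).toCoalgHom (u ≫ M.map α)).lin (m α) := by
  have h : exDescApp u y = _ := dif_pos (leOfHom α)
  rw [h]
  rfl

/-- The morphism `ex_x(N) → M` that corresponds to a morphism `N → M_x`. -/
noncomputable def exDesc {M : TransContramodule 𝒞} (u : N ⟶ M.obj x) : exObj 𝒞 x N ⟶ M where
  app y := exDescApp u y
  naturality {z y} β := by
    by_cases h : y ≤ x
    · let α := homOfLE h
      refine Contramodule.hom_ext (LinearMap.ext fun m => ?_)
      refine (exDescApp_lin u (β ≫ α) _).trans (Eq.trans ?_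
        (congrArg (M.map β).lin (exDescApp_lin u α m).symm))
      refine (congrArg _ (exComponent_lin 𝒞 x N β (β ≫ α) α m)).trans ?_
      obtain ⟨f, hf⟩ := Submodule.mkQ_surjective _ (m α)
      rw [← hf]
      refine Eq.trans ?_ ((M.map β).comm _).symm
      exact congrArg (M.obj z).π (LinearMap.ext fun c => M.map_comp β α _)
    · have : Subsingleton ((exObj 𝒞 x N).obj y).carrier := exValue_subsingleton 𝒞 x N h
      exact Contramodule.hom_ext (Subsingleton.elim _ _)

theorem exDesc_exUnit {M : TransContramodule 𝒞} (u : N ⟶ M.obj x) (n : N.carrier) :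
    ((exDesc u).app x).lin ((exUnit 𝒞 x N).lin n) = u.lin n :=
  (exDescApp_lin u (𝟙 x) _).trans
    ((Contramodule.contraextensionDesc_lin_unit _ _ n).trans (M.map_id x _))

variable (𝒞 x) in
/-- The functor `ex_x` is left adjoint to the evaluation at `x`. -/
noncomputable def exAdjunction : ex 𝒞 x ⊣ eval 𝒞 x :=
  Adjunction.mkOfHomEquiv
    { homEquiv N M :=
        { toFun f := exUnit 𝒞 x N ≫ f.app x
          invFun u := exDesc u
          left_inv f := ex_hom_ext fun n => exDesc_exUnit _ n
          right_inv u := Contramodule.hom_ext (LinearMap.ext fun n => exDesc_exUnit u n) }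
      homEquiv_naturality_left_symm {N N' M} u v := ex_hom_ext fun n => by
        refine (exDesc_exUnit _ n).trans ((exDesc_exUnit v (u.lin n)).symm.trans ?_)
        refine congrArg ((exDesc v).app x).lin (funext fun α => ?_)
        exact congrArg (Submodule.mkQ _) (Contramodule.comp_unit u.lin n).symm
      homEquiv_naturality_right f g := rfl }

end Extension

section

variable {K : Type u} [Field K] {X : Type u} [PartialOrder X] (𝒞 : X ⥤ CoalgCat.{u} K)

instance (x : X) : PreservesLimits (eval 𝒞 x) :=
  (exAdjunction 𝒞 x).rightAdjoint_preservesLimits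

instance : HasLimits (TransContramodule 𝒞) :=
  hasLimits_of_jointlyReflectIsomorphisms (exAdjunction 𝒞) (jointlyReflectIsomorphisms_eval 𝒞)

noncomputable instance : Abelian (TransContramodule 𝒞) :=
  have := hasFiniteProducts_of_hasProducts (TransContramodule 𝒞)
  abelianOfJointlyReflectIsomorphisms (jointlyReflectIsomorphisms_eval 𝒞)

theorem projective_ex_dual (x : X) : Projective ((ex 𝒞 x).obj (Contramodule.dual K (𝒞.obj x))) :=
  (exAdjunction 𝒞 x).map_projective _ inferInstance

theorem isStrongGenerator_ex_dual : (ObjectProperty.ofObj fun x : X =>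
    (ex 𝒞 x).obj (Contramodule.dual K (𝒞.obj x))).IsStrongGenerator :=
  isStrongGenerator_of_isSeparating <|
    isSeparating_of_adjunctions (exAdjunction 𝒞) (jointlyFaithful_eval 𝒞)
      (fun x => Contramodule.isSeparator_dual K (𝒞.obj x)) fun x => by
        rintro _ ⟨⟩
        exact ⟨x⟩

variable (κ : Cardinal.{u}) [Fact κ.IsRegular]

theorem isCardinalPresentable_ex_obj (x : X) (N : Contramodule K (𝒞.obj x))
    [IsCardinalPresentable N κ] : IsCardinalPresentable ((ex 𝒞 x).obj N) κ :=
  (exAdjunction 𝒞 x).isCardinalPresentable_leftAdjoint_obj κ N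

theorem isCardinalLocallyPresentable
    [∀ x : X, IsCardinalPresentable (Contramodule.dual K (𝒞.obj x)) κ] :
    IsCardinalLocallyPresentable (TransContramodule 𝒞) κ := by
  rw [IsCardinalLocallyPresentable.iff_exists_isStrongGenerator]
  refine ⟨_, inferInstance, isStrongGenerator_ex_dual 𝒞, ?_⟩
  rintro _ ⟨x⟩
  exact isCardinalPresentable_ex_obj 𝒞 κ x _

end

end TransContramodule

theorem mainTheorem8 {K : Type u} [Field K] {X : Type u} [PartialOrder X]
    (𝒞 : X ⥤ CoalgCat.{u} K) :
    Nonempty (Abelian (TransContramodule 𝒞)) ∧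
    IsLocallyPresentable.{u} (TransContramodule 𝒞) ∧
    (ObjectProperty.ofObj fun x : X =>
      (TransContramodule.ex 𝒞 x).obj (Contramodule.dual K (𝒞.obj x))).IsStrongGenerator ∧
    (∀ x : X, Projective ((TransContramodule.ex 𝒞 x).obj (Contramodule.dual K (𝒞.obj x)))) ∧
    (∃ (κ : Cardinal.{u}) (_ : Fact κ.IsRegular),
      ∀ x : X, IsCardinalPresentable (Contramodule.dual K (𝒞.obj x)) κ) ∧
    (∀ (κ : Cardinal.{u}) [Fact κ.IsRegular],
      (∀ x : X, IsCardinalPresentable (Contramodule.dual K (𝒞.obj x)) κ) →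
        (∀ x : X, IsCardinalPresentable
          ((TransContramodule.ex 𝒞 x).obj (Contramodule.dual K (𝒞.obj x))) κ) ∧
        IsCardinalLocallyPresentable (TransContramodule 𝒞) κ) := by
  obtain ⟨κ, hκ, h⟩ := Contramodule.exists_isCardinalPresentable_dual fun x => 𝒞.obj x
  exact ⟨⟨inferInstance⟩,
    ⟨κ, hκ, TransContramodule.isCardinalLocallyPresentable 𝒞 κ⟩,
    TransContramodule.isStrongGenerator_ex_dual 𝒞,
    TransContramodule.projective_ex_dual 𝒞,
    ⟨κ, hκ, h⟩,
    fun κ _ _ => ⟨fun x => TransContramodule.isCardinalPresentable_ex_obj 𝒞 κ x _,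
      TransContramodule.isCardinalLocallyPresentable 𝒞 κ⟩⟩
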